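/- All graphs are finite, simple and undirected. For a connected graph $G$ let $D(G)$ be its distance matrix and $\lambda_1(D(G))$ the largest eigenvalue of $D(G)$. For a vertex set $S$ let $c(G-S)$ be the number of connected components of $G-S$, and call $S$ a cut set if $G-S$ is disconnected. The toughness of $G$ is $\tau(G)=\min\{|S|/c(G-S) : S \text{ is a cut set of } G\}$, with $\tau(G)=\infty$ if $G$ is complete, and $G$ is called $t$-tough if $\tau(G)\ge t$. Write $G_1+G_2$ for the disjoint union, $kG_1$ for the disjoint union of $k$ copies of $G_1$, and $G_1\vee G_2$ for the join (the disjoint union together with all edges between $G_1$ and $G_2$). Let $G$ be a connected graph of order $n$. (i) Let $t$ be a positive integer and $n\ge 4t^2+10t$. If $\lambda_1(D(G))\le\lambda_1(D(K_{2t-1}\vee(K_{n-2t}+K_1)))$, then $G$ is $t$-tough unless $G\cong K_{2t-1}\vee(K_{n-2t}+K_1)$, in which case $G$ is not $t$-tough. (ii) Let $t$ be a real number such that $\frac1t$ is a positive integer, and let $n\ge 2t+\frac{9}{2t}+\frac92$. If $\lambda_1(D(G))\le\lambda_1(D(K_1\vee(K_{n-1-\frac1t}+\frac1t K_1)))$,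 then $G$ is $t$-tough unless $G\cong K_1\vee(K_{n-1-\frac1t}+\frac1t K_1)$, in which case $G$ is not $t$-tough. -/

import Mathlib

namespace SimpleGraph

/-- The join `G ∨ H`: the disjoint union of `G` and `H` together with all edges between them. -/
def join {V W : Type*} (G : SimpleGraph V) (H : SimpleGraph W) : SimpleGraph (V ⊕ W) :=
  (G ⊕g H) ⊔ completeBipartiteGraph V W

/-- The distance matrix `D(G)`. -/
noncomputable def distMatrix {V : Type*} (G : SimpleGraph V) : Matrix V V ℝ :=
  Matrix.of fun u v => (G.dist u v : ℝ)

theorem distMatrix_isHermitian {V : Type*} (G : SimpleGraph V) : G.distMatrix.IsHermitian := by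
  ext u v
  simp [distMatrix, dist_comm]

/-- The distance spectral radius `λ₁(D(G))`: the largest eigenvalue of the distance matrix
(a maximum over a finite family, nonempty as soon as `G` has a vertex). -/
noncomputable def distSpectralRadius {V : Type*} [Fintype V] [DecidableEq V]
    (G : SimpleGraph V) : ℝ :=
  ⨆ i, G.distMatrix_isHermitian.eigenvalues i

/-- `c(G - S)`: the number of connected components of the graph obtained by deleting `S`. -/
noncomputable def numCompDelete {V : Type*} (G : SimpleGraph V) (S : Finset V) : ℕ :=
  Nat.card (G.induce ((S : Set V)ᶜ)).ConnectedComponent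

/-- `S` is a cut set of vertices: `G - S` is disconnected (has two vertices that are not joined
by a walk). -/
def IsCutSet {V : Type*} (G : SimpleGraph V) (S : Finset V) : Prop :=
  ¬ (G.induce ((S : Set V)ᶜ)).Preconnected

/-- The toughness `τ(G) = min {|S| / c(G - S) : S a cut set of G}`. A complete graph has no
cut set, and its toughness is `⊤`. -/
noncomputable def toughness {V : Type*} (G : SimpleGraph V) : EReal :=
  ⨅ (S : Finset V) (_ : G.IsCutSet S), (((S.card : ℝ) / (G.numCompDelete S : ℝ) : ℝ) : EReal)

/-- `G` is `t`-tough if `τ(G) ≥ t`. -/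
def IsTough {V : Type*} (G : SimpleGraph V) (t : ℝ) : Prop :=
  (t : EReal) ≤ G.toughness

/-- The graph `K_s ∨ (K_m + k K₁)`. -/
def cliqueJoin (s m k : ℕ) : SimpleGraph (Fin s ⊕ (Fin m ⊕ Fin k)) :=
  join (completeGraph (Fin s)) (completeGraph (Fin m) ⊕g (⊥ : SimpleGraph (Fin k)))

end SimpleGraph

/-!
A graph `G` that is not `t`-tough has a set `S` whose removal leaves `c > |S| / t` components, so it
is a spanning subgraph of some `K_{|S|} ∨ (K_{n₁} + ⋯ + K_{n_c})`, whose distances are all `1` or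
`2`. Distances only grow in a connected spanning subgraph, so by Perron–Frobenius `λ₁` does too,
strictly unless the graphs are equal.

If `(|S|, c)` is not, up to enlarging `S`, the pair of parameters of the extremal graph
`K_s ∨ (K_m + k K₁)`, then the average row sum of the distance matrix is already too large:
it exceeds a Collatz–Wielandt upper bound for `λ₁` of the extremal graph. Otherwise let `x` be the
Perron vector of the extremal graph, with value `q` on `K_m` and `p` on the isolated vertices. Since
`p < 2 q`, moving vertices from the largest clique to smaller ones, while at least two remain in it,
increases the quadratic form of the distance matrix at `x`, hence increases `λ₁`.
-/

namespace DistanceToughness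

open Matrix

section MaxEigenvalue

variable {ι : Type*} [Fintype ι] {A B : Matrix ι ι ℝ}

theorem dotProduct_mulVec_mono (hAB : ∀ i j, A i j ≤ B i j) {x : ι → ℝ} (hx : ∀ i, 0 ≤ x i) :
    x ⬝ᵥ A *ᵥ x ≤ x ⬝ᵥ B *ᵥ x :=
  Finset.sum_le_sum fun i _ => mul_le_mul_of_nonneg_left
    (Finset.sum_le_sum fun j _ => mul_le_mul_of_nonneg_right (hAB i j) (hx j)) (hx i)

theorem dotProduct_mulVec_le_abs (hA : ∀ i j, i ≠ j → 0 ≤ A i j) (x : ι → ℝ) :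
    x ⬝ᵥ A *ᵥ x ≤ |x| ⬝ᵥ A *ᵥ |x| := by
  simp only [dotProduct, mulVec, Finset.mul_sum, Pi.abs_apply]
  refine Finset.sum_le_sum fun i _ => Finset.sum_le_sum fun j _ => ?_
  rw [mul_left_comm, mul_left_comm |x i|, ← abs_mul]
  rcases eq_or_ne i j with rfl | hij
  · rw [abs_mul_self]
  · exact mul_le_mul_of_nonneg_left (le_abs_self _) (hA i j hij)

theorem pos_of_mulVec_eq_smul (hA : ∀ i j, i ≠ j → 0 < A i j) {x : ι → ℝ} (hx : 0 ≤ x)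
    (hx₀ : x ≠ 0) {μ : ℝ} (hAx : A *ᵥ x = μ • x) (i : ι) : 0 < x i := by
  refine (hx i).lt_of_ne' fun hi => hx₀ ?_
  have hrow : ∑ j, A i j * x j = 0 := (congrFun hAx i).trans (by simp [hi])
  have hterm : ∀ j, 0 ≤ A i j * x j := fun j => by
    rcases eq_or_ne i j with rfl | hij
    · simp [hi]
    · exact mul_nonneg (hA i j hij).le (hx j)
  funext j
  rcases eq_or_ne i j with rfl | hij
  · exact hi
  · have := (Finset.sum_eq_zero_iff_of_nonneg fun j _ => hterm j).1 hrow j (Finset.mem_univ j)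
    exact (mul_eq_zero_iff_left (hA i j hij).ne').1 this

variable [DecidableEq ι]

/-- The largest eigenvalue of a real symmetric matrix; it is `0` when the index type is empty. -/
noncomputable def maxEigenvalue (hA : A.IsHermitian) : ℝ :=
  ⨆ i, hA.eigenvalues i

theorem maxEigenvalue_eq_sSup_spectrum (hA : A.IsHermitian) :
    maxEigenvalue hA = sSup (spectrum ℝ A) := by
  rw [hA.spectrum_real_eq_range_eigenvalues, sSup_range, maxEigenvalue]

theorem posSemidef_maxEigenvalue_smul_one_sub (hA : A.IsHermitian) :
    (maxEigenvalue hA • (1 : Matrix ι ι ℝ) - A).PosSemidef := by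
  open scoped MatrixOrder in
  rw [← Matrix.le_iff, ← Algebra.algebraMap_eq_smul_one]
  refine le_algebraMap_of_spectrum_le (fun μ hμ => ?_) hA.isSelfAdjoint
  rw [hA.spectrum_real_eq_range_eigenvalues] at hμ
  obtain ⟨i, rfl⟩ := hμ
  exact le_ciSup (Set.finite_range _).bddAbove i

theorem dotProduct_smul_one_sub_mulVec (A : Matrix ι ι ℝ) (μ : ℝ) (x : ι → ℝ) :
    x ⬝ᵥ (μ • (1 : Matrix ι ι ℝ) - A) *ᵥ x = μ * (x ⬝ᵥ x) - x ⬝ᵥ A *ᵥ x := by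
  rw [sub_mulVec, smul_mulVec, one_mulVec, dotProduct_sub, dotProduct_smul, smul_eq_mul]

theorem dotProduct_mulVec_le_maxEigenvalue_mul (hA : A.IsHermitian) (x : ι → ℝ) :
    x ⬝ᵥ A *ᵥ x ≤ maxEigenvalue hA * (x ⬝ᵥ x) := by
  have h := (posSemidef_maxEigenvalue_smul_one_sub hA).dotProduct_mulVec_nonneg x
  rwa [star_trivial, dotProduct_smul_one_sub_mulVec, sub_nonneg] at h

theorem mulVec_eq_maxEigenvalue_smul (hA : A.IsHermitian) {x : ι → ℝ}
    (hx : maxEigenvalue hA * (x ⬝ᵥ x) ≤ x ⬝ᵥ A *ᵥ x) :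
    A *ᵥ x = maxEigenvalue hA • x := by
  have h := (posSemidef_maxEigenvalue_smul_one_sub hA).dotProduct_mulVec_zero_iff x
  rw [star_trivial, dotProduct_smul_one_sub_mulVec, sub_eq_zero, sub_mulVec, smul_mulVec,
    one_mulVec, sub_eq_zero] at h
  exact (h.1 (hx.antisymm (dotProduct_mulVec_le_maxEigenvalue_mul hA x))).symm

theorem exists_ne_zero_mulVec_eq_maxEigenvalue_smul [Nonempty ι] (hA : A.IsHermitian) :
    ∃ x : ι → ℝ, x ≠ 0 ∧ A *ᵥ x = maxEigenvalue hA • x := by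
  obtain ⟨i, hi⟩ := exists_eq_ciSup_of_finite (f := hA.eigenvalues)
  refine ⟨hA.eigenvectorBasis i, fun h => ?_, ?_⟩
  · exact hA.eigenvectorBasis.orthonormal.ne_zero i (WithLp.ofLp_injective 2 h)
  · rw [hA.mulVec_eigenvectorBasis, hi, maxEigenvalue]

theorem maxEigenvalue_submatrix_equiv {κ : Type*} [Fintype κ] [DecidableEq κ] (hA : A.IsHermitian)
    (e : κ ≃ ι) : maxEigenvalue (hA.submatrix e) = maxEigenvalue hA := by
  rw [maxEigenvalue_eq_sSup_spectrum, maxEigenvalue_eq_sSup_spectrum,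
    ← AlgEquiv.spectrum_eq (reindexAlgEquiv ℝ ℝ e)]
  simp

theorem exists_pos_mulVec_eq_maxEigenvalue_smul [Nonempty ι] (hA : A.IsHermitian)
    (hpos : ∀ i j, i ≠ j → 0 < A i j) :
    ∃ x : ι → ℝ, (∀ i, 0 < x i) ∧ A *ᵥ x = maxEigenvalue hA • x := by
  obtain ⟨z, hz, hAz⟩ := exists_ne_zero_mulVec_eq_maxEigenvalue_smul hA
  have habs : A *ᵥ |z| = maxEigenvalue hA • |z| := by
    refine mulVec_eq_maxEigenvalue_smul hA ?_
    calc maxEigenvalue hA * (|z| ⬝ᵥ |z|) = maxEigenvalue hA * (z ⬝ᵥ z) := by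
          simp [dotProduct]
      _ = z ⬝ᵥ A *ᵥ z := by rw [hAz, dotProduct_smul, smul_eq_mul]
      _ ≤ |z| ⬝ᵥ A *ᵥ |z| := dotProduct_mulVec_le_abs (fun i j hij => (hpos i j hij).le) z
  refine ⟨|z|, pos_of_mulVec_eq_smul hpos (abs_nonneg z) (fun h => hz ?_) habs, habs⟩
  exact funext fun i => abs_eq_zero.1 (congrFun h i)

/-- Collatz–Wielandt bound. -/
theorem maxEigenvalue_lt_of_mulVec_lt [Nonempty ι] (hA : A.IsHermitian)
    (hpos : ∀ i j, i ≠ j → 0 < A i j) {y : ι → ℝ} (hy : ∀ i, 0 < y i) {μ : ℝ}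
    (hlt : A *ᵥ y < μ • y) : maxEigenvalue hA < μ := by
  obtain ⟨x, hx, hAx⟩ := exists_pos_mulVec_eq_maxEigenvalue_smul hA hpos
  obtain ⟨hle, i, hi⟩ := Pi.lt_def.1 hlt
  have hxy : 0 < x ⬝ᵥ y :=
    Finset.sum_pos (fun i _ => mul_pos (hx i) (hy i)) Finset.univ_nonempty
  have h : x ⬝ᵥ A *ᵥ y < x ⬝ᵥ μ • y :=
    Finset.sum_lt_sum (fun j _ => mul_le_mul_of_nonneg_left (hle j) (hx j).le)
      ⟨i, Finset.mem_univ i, mul_lt_mul_of_pos_left hi (hx i)⟩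
  have hsymm : x ⬝ᵥ A *ᵥ y = maxEigenvalue hA * (x ⬝ᵥ y) := by
    rw [dotProduct_mulVec, ← mulVec_transpose, ← conjTranspose_eq_transpose_of_trivial, hA.eq, hAx,
      smul_dotProduct, smul_eq_mul]
  rw [hsymm, dotProduct_smul, smul_eq_mul] at h
  exact lt_of_mul_lt_mul_right h hxy.le

theorem maxEigenvalue_mono [Nonempty ι] (hA : A.IsHermitian) (hB : B.IsHermitian)
    (hpos : ∀ i j, i ≠ j → 0 < A i j) (hAB : ∀ i j, A i j ≤ B i j) :
    maxEigenvalue hA ≤ maxEigenvalue hB := by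
  obtain ⟨x, hx, hAx⟩ := exists_pos_mulVec_eq_maxEigenvalue_smul hA hpos
  have hxx : 0 < x ⬝ᵥ x := Finset.sum_pos (fun i _ => mul_pos (hx i) (hx i)) Finset.univ_nonempty
  have h := (dotProduct_mulVec_mono hAB fun i => (hx i).le).trans
    (dotProduct_mulVec_le_maxEigenvalue_mul hB x)
  rw [hAx, dotProduct_smul, smul_eq_mul] at h
  exact le_of_mul_le_mul_right h hxx

theorem eq_of_le_of_maxEigenvalue_le (hA : A.IsHermitian) (hB : B.IsHermitian)
    (hpos : ∀ i j, i ≠ j → 0 < A i j) (hAB : ∀ i j, A i j ≤ B i j)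
    (hle : maxEigenvalue hB ≤ maxEigenvalue hA) : A = B := by
  ext i j
  have : Nonempty ι := ⟨i⟩
  obtain ⟨x, hx, hAx⟩ := exists_pos_mulVec_eq_maxEigenvalue_smul hA hpos
  have hxx : 0 ≤ x ⬝ᵥ x := Finset.sum_nonneg fun i _ => mul_self_nonneg (x i)
  have heq : x ⬝ᵥ A *ᵥ x = x ⬝ᵥ B *ᵥ x := by
    refine (dotProduct_mulVec_mono hAB fun i => (hx i).le).antisymm ?_
    rw [hAx, dotProduct_smul, smul_eq_mul]
    exact (dotProduct_mulVec_le_maxEigenvalue_mul hB x).trans (mul_le_mul_of_nonneg_right hle hxx)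
  have hrow : (A *ᵥ x) i = (B *ᵥ x) i := by
    have hmono : ∀ i, (A *ᵥ x) i ≤ (B *ᵥ x) i := fun i =>
      Finset.sum_le_sum fun j _ => mul_le_mul_of_nonneg_right (hAB i j) (hx j).le
    have h := (Finset.sum_eq_sum_iff_of_le fun i _ =>
      mul_le_mul_of_nonneg_left (hmono i) (hx i).le).1 heq i (Finset.mem_univ i)
    exact mul_left_cancel₀ (hx i).ne' h
  have h := (Finset.sum_eq_sum_iff_of_le fun j _ =>
    mul_le_mul_of_nonneg_right (hAB i j) (hx j).le).1 hrow j (Finset.mem_univ j)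
  exact mul_right_cancel₀ (hx j).ne' h

end MaxEigenvalue

section DistSpectralRadius

open SimpleGraph

variable {V W : Type*} {G H : SimpleGraph V}

theorem distMatrix_pos (hG : G.Connected) (u v : V) (huv : u ≠ v) : 0 < G.distMatrix u v :=
  Nat.cast_pos.2 (hG.pos_dist_of_ne huv)

theorem distMatrix_anti (hG : G.Connected) (hle : G ≤ H) (u v : V) :
    H.distMatrix u v ≤ G.distMatrix u v :=
  Nat.cast_le.2 ((hG u v).dist_anti hle)

theorem dist_map_le_of_connected {G' : SimpleGraph W} (hG : G.Connected) (φ : G →g G') (u v : V) :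
    G'.dist (φ u) (φ v) ≤ G.dist u v := by
  obtain ⟨p, hp⟩ := hG.exists_walk_length_eq_dist u v
  rw [← hp, ← p.length_map φ]
  exact dist_le _

theorem dist_map_iso_of_connected {G' : SimpleGraph W} (hG : G.Connected) (φ : G ≃g G') (u v : V) :
    G'.dist (φ u) (φ v) = G.dist u v :=
  (dist_map_le_of_connected hG φ.toHom u v).antisymm <| by
    simpa using dist_map_le_of_connected (φ.connected_iff.1 hG) φ.symm.toHom (φ u) (φ v)

variable [Fintype V] [DecidableEq V]

theorem distSpectralRadius_eq_maxEigenvalue (G : SimpleGraph V) :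
    G.distSpectralRadius = maxEigenvalue G.distMatrix_isHermitian :=
  rfl

theorem distSpectralRadius_eq_of_iso [Fintype W] [DecidableEq W] {G' : SimpleGraph W}
    (hG : G.Connected) (φ : G ≃g G') : G.distSpectralRadius = G'.distSpectralRadius := by
  have hsub : G.distMatrix = G'.distMatrix.submatrix φ.toEquiv φ.toEquiv := by
    ext u v
    exact congrArg Nat.cast (dist_map_iso_of_connected hG φ u v).symm
  simp only [distSpectralRadius_eq_maxEigenvalue, hsub]
  exact maxEigenvalue_submatrix_equiv G'.distMatrix_isHermitian φ.toEquiv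

theorem distSpectralRadius_anti (hG : G.Connected) (hle : G ≤ H) :
    H.distSpectralRadius ≤ G.distSpectralRadius :=
  have := hG.nonempty
  maxEigenvalue_mono _ _ (distMatrix_pos (hG.mono hle)) (distMatrix_anti hG hle)

theorem eq_of_le_of_distSpectralRadius_le (hG : G.Connected) (hle : G ≤ H)
    (hrad : G.distSpectralRadius ≤ H.distSpectralRadius) : G = H := by
  have hdist := eq_of_le_of_maxEigenvalue_le H.distMatrix_isHermitian G.distMatrix_isHermitian
    (distMatrix_pos (hG.mono hle)) (distMatrix_anti hG hle) hrad
  ext u v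
  rw [← dist_eq_one_iff_adj, ← dist_eq_one_iff_adj]
  have h : (H.dist u v : ℝ) = G.dist u v := congrFun₂ hdist u v
  rw [Nat.cast_injective h]

theorem distSpectralRadius_lt_of_distMatrix_mulVec_lt (hG : G.Connected) {y : V → ℝ}
    (hy : ∀ v, 0 < y v) {μ : ℝ} (hlt : G.distMatrix *ᵥ y < μ • y) : G.distSpectralRadius < μ :=
  have := hG.nonempty
  maxEigenvalue_lt_of_mulVec_lt _ (distMatrix_pos hG) hy hlt

end DistSpectralRadius

section JoinOfCliques

open SimpleGraph

variable {V ι : Type*} {S T : Finset V} {F : V → ι}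

/-- The graph `K_s ∨ (K_{n₁} + ⋯ + K_{n_c})`, presented on a given vertex set: `S` is the set of `s`
dominating vertices and the cliques are the fibres of `F` on the complement of `S` (the values of
`F` on `S` are irrelevant). Thus `G ≤ joinOfCliques S F` says that `F` is constant on the components
of `G - S`. -/
def joinOfCliques (S : Finset V) (F : V → ι) : SimpleGraph V where
  Adj u v := u ≠ v ∧ (u ∈ S ∨ v ∈ S ∨ F u = F v)
  symm := ⟨fun u v h => ⟨h.1.symm, by tauto⟩⟩
  loopless := ⟨fun u h => h.1 rfl⟩

theorem joinOfCliques_adj {u v : V} :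
    (joinOfCliques S F).Adj u v ↔ u ≠ v ∧ (u ∈ S ∨ v ∈ S ∨ F u = F v) :=
  Iff.rfl

theorem joinOfCliques_mono (hST : S ⊆ T) : joinOfCliques S F ≤ joinOfCliques T F :=
  fun _ _ h => ⟨h.1, h.2.imp (@hST _) (Or.imp_left (@hST _))⟩

theorem joinOfCliques_le_comp {κ : Type*} (f : ι → κ) :
    joinOfCliques S F ≤ joinOfCliques S (f ∘ F) :=
  fun _ _ h => ⟨h.1, h.2.imp_right (Or.imp_right (congrArg f))⟩

theorem joinOfCliques_connected (hS : S.Nonempty) : (joinOfCliques S F).Connected := by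
  obtain ⟨a, ha⟩ := hS
  have hreach : ∀ u, (joinOfCliques S F).Reachable a u := fun u => by
    rcases eq_or_ne a u with rfl | hau
    · rfl
    · exact Adj.reachable ⟨hau, .inl ha⟩
  exact connected_iff_exists_forall_reachable _ |>.2 ⟨a, hreach⟩

theorem joinOfCliques_dist_eq_two (hS : S.Nonempty) {u v : V} (huv : u ≠ v)
    (hadj : ¬ (joinOfCliques S F).Adj u v) : (joinOfCliques S F).dist u v = 2 := by
  obtain ⟨a, ha⟩ := hS
  have hau : a ≠ u := fun h => hadj ⟨huv, .inl (h ▸ ha)⟩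
  have hav : a ≠ v := fun h => hadj ⟨huv, .inr (.inl (h ▸ ha))⟩
  have hua : (joinOfCliques S F).Adj u a := ⟨hau.symm, .inr (.inl ha)⟩
  have hav' : (joinOfCliques S F).Adj a v := ⟨hav, .inl ha⟩
  exact (dist_le (.cons hua (.cons hav' .nil))).antisymm
    ((joinOfCliques_connected ⟨a, ha⟩).one_lt_dist_of_ne_of_not_adj huv hadj)

theorem joinOfCliques_distMatrix [DecidableEq V] [DecidableEq ι] (hS : S.Nonempty) (u v : V) :
    (joinOfCliques S F).distMatrix u v = 1 - (if u = v then 1 else 0) +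
      if u ∉ S ∧ v ∉ S ∧ F v ≠ F u then 1 else 0 := by
  change ((joinOfCliques S F).dist u v : ℝ) = _
  rcases eq_or_ne u v with rfl | huv
  · simp
  by_cases hadj : (joinOfCliques S F).Adj u v
  · rw [dist_eq_one_iff_adj.2 hadj, if_neg huv, if_neg]
    · norm_num
    · rintro ⟨hu, hv, hF⟩
      exact hadj.2.elim hu (Or.rec hv hF.symm)
  · rw [joinOfCliques_dist_eq_two hS huv hadj, if_neg huv, if_pos]
    · norm_num
    · exact ⟨fun hu => hadj ⟨huv, .inl hu⟩, fun hv => hadj ⟨huv, .inr (.inl hv)⟩,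
        fun hF => hadj ⟨huv, .inr (.inr hF.symm)⟩⟩

variable [Fintype V] [DecidableEq V]

theorem joinOfCliques_distMatrix_mulVec [DecidableEq ι] (hS : S.Nonempty) (x : V → ℝ) (u : V) :
    ((joinOfCliques S F).distMatrix *ᵥ x) u = ∑ v, x v - x u +
      if u ∈ S then 0 else ∑ v ∈ Sᶜ with F v ≠ F u, x v := by
  simp only [mulVec, dotProduct, joinOfCliques_distMatrix hS, add_mul, sub_mul, one_mul, ite_mul,
    zero_mul, Finset.sum_add_distrib, Finset.sum_sub_distrib, Finset.sum_ite_eq, Finset.mem_univ,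
    if_true]
  congr 1
  split_ifs with hu
  · simp [hu]
  · simp [hu, Finset.sum_ite, Finset.filter_filter, Finset.compl_eq_univ_sdiff,
      Finset.sdiff_eq_filter]

theorem dotProduct_joinOfCliques_distMatrix_mulVec [Fintype ι] [DecidableEq ι] (hS : S.Nonempty)
    (x : V → ℝ) :
    x ⬝ᵥ (joinOfCliques S F).distMatrix *ᵥ x = (∑ v, x v) ^ 2 - ∑ v, x v ^ 2 +
      ((∑ v ∈ Sᶜ, x v) ^ 2 - ∑ i, (∑ v ∈ Sᶜ with F v = i, x v) ^ 2) := by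
  have hoff : ∀ u, ∑ v ∈ Sᶜ with F v ≠ F u, x v =
      ∑ v ∈ Sᶜ, x v - ∑ v ∈ Sᶜ with F v = F u, x v := fun u =>
    eq_sub_of_add_eq' (Finset.sum_filter_add_sum_filter_not _ _ _)
  have hfib : ∑ u ∈ Sᶜ, x u * ∑ v ∈ Sᶜ with F v = F u, x v =
      ∑ i, (∑ v ∈ Sᶜ with F v = i, x v) ^ 2 := by
    rw [← Finset.sum_fiberwise Sᶜ F]
    refine Finset.sum_congr rfl fun i _ => ?_
    rw [sq, Finset.sum_mul]
    exact Finset.sum_congr rfl fun u hu => by rw [(Finset.mem_filter.1 hu).2]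
  have hcompl : ∀ f : V → ℝ, ∑ u, (if u ∈ S then 0 else f u) = ∑ u ∈ Sᶜ, f u := fun f => by
    simp [Finset.sum_ite, Finset.compl_eq_univ_sdiff, Finset.sdiff_eq_filter]
  simp only [dotProduct, joinOfCliques_distMatrix_mulVec hS, hoff, mul_add, mul_sub, mul_ite,
    mul_zero, Finset.sum_add_distrib, Finset.sum_sub_distrib, hcompl, hfib, ← Finset.sum_mul, sq]

end JoinOfCliques

section Toughness

open SimpleGraph

variable {V ι : Type*} {G : SimpleGraph V} {S : Finset V}

theorem eq_of_reachable_of_forall_adj {F : V → ι} (hF : ∀ u v, G.Adj u v → F u = F v) {u v : V}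
    (h : G.Reachable u v) : F u = F v := by
  obtain ⟨p⟩ := h
  induction p with
  | nil => rfl
  | cons huv _ ih => exact (hF _ _ huv).trans ih

theorem card_le_numCompDelete_of_le_joinOfCliques [Finite V] [Fintype ι] {F : V → ι}
    (hF : G ≤ joinOfCliques S F) (hsurj : ∀ i, ∃ u ∉ S, F u = i) :
    Fintype.card ι ≤ G.numCompDelete S := by
  have hadj : ∀ u v : ((S : Set V)ᶜ : Set V), (G.induce (S : Set V)ᶜ).Adj u v → F u = F v :=
    fun u v huv => ((hF huv).2.resolve_left u.2).resolve_left v.2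
  rw [← Nat.card_eq_fintype_card]
  refine Nat.card_le_card_of_surjective (ConnectedComponent.lift (fun v => F v) fun u v p _ =>
    eq_of_reachable_of_forall_adj (F := fun v => F v.1) hadj p.reachable) fun i => ?_
  obtain ⟨u, hu, hui⟩ := hsurj i
  exact ⟨connectedComponentMk _ ⟨u, hu⟩, hui⟩

theorem exists_le_joinOfCliques_of_card_le_numCompDelete [Finite V] [Fintype ι] [Nonempty ι]
    (h : Fintype.card ι ≤ G.numCompDelete S) :
    ∃ F : V → ι, G ≤ joinOfCliques S F ∧ ∀ i, ∃ u ∉ S, F u = i := by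
  classical
  have := Fintype.ofFinite (G.induce ((S : Set V)ᶜ)).ConnectedComponent
  rw [numCompDelete, Nat.card_eq_fintype_card] at h
  obtain ⟨f⟩ := Function.Embedding.nonempty_of_card_le h
  let F : V → ι := fun v => if hv : v ∈ S then Classical.arbitrary ι else
    Function.invFun f ((G.induce ((S : Set V)ᶜ)).connectedComponentMk ⟨v, hv⟩)
  have hF : ∀ v (hv : v ∉ S), F v = Function.invFun f (connectedComponentMk _ ⟨v, hv⟩) :=
    fun v hv => dif_neg hv
  refine ⟨F, fun u v huv => ⟨huv.ne, ?_⟩, fun i => ?_⟩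
  · by_contra! ⟨hu, hv, hne⟩
    have hcomp : (G.induce ((S : Set V)ᶜ)).connectedComponentMk ⟨u, hu⟩ =
        connectedComponentMk _ ⟨v, hv⟩ := ConnectedComponent.sound (Adj.reachable huv)
    exact hne (by rw [hF u hu, hF v hv, hcomp])
  · obtain ⟨⟨u, hu⟩, hui⟩ := (f i).exists_rep
    exact ⟨u, hu, (hF u hu).trans <| (congrArg _ hui).trans <|
      Function.leftInverse_invFun f.injective i⟩

theorem exists_le_joinOfCliques_one_lt_card_fiber [Fintype V] [DecidableEq V] [Fintype ι]
    [DecidableEq ι] (i₀ : ι) (h : Fintype.card ι ≤ G.numCompDelete S)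
    (hcard : Fintype.card ι < (Sᶜ).card) :
    ∃ F : V → ι, G ≤ joinOfCliques S F ∧ (∀ i, ∃ u ∉ S, F u = i) ∧
      1 < (Sᶜ.filter fun u => F u = i₀).card := by
  have : Nonempty ι := ⟨i₀⟩
  obtain ⟨F, hF, hsurj⟩ := exists_le_joinOfCliques_of_card_le_numCompDelete h
  obtain ⟨u, hu, v, hv, huv, hFuv⟩ := Finset.exists_ne_map_eq_of_card_lt_of_maps_to
    (t := Finset.univ) (f := F) hcard fun _ _ => Finset.mem_coe.2 (Finset.mem_univ _)
  let σ := Equiv.swap (F u) i₀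
  refine ⟨σ ∘ F, hF.trans (joinOfCliques_le_comp σ), fun i => ?_,
    Finset.one_lt_card.2 ⟨u, ?_, v, ?_, huv⟩⟩
  · obtain ⟨w, hw, hwi⟩ := hsurj (σ.symm i)
    exact ⟨w, hw, by rw [Function.comp_apply, hwi, σ.apply_symm_apply]⟩
  · exact Finset.mem_filter.2 ⟨hu, Equiv.swap_apply_left _ _⟩
  · exact Finset.mem_filter.2 ⟨hv, (congrArg σ hFuv).symm.trans (Equiv.swap_apply_left _ _)⟩

theorem isCutSet_iff_one_lt_numCompDelete [Finite V] : G.IsCutSet S ↔ 1 < G.numCompDelete S := by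
  rw [IsCutSet, numCompDelete, Finite.one_lt_card_iff_nontrivial, ← not_subsingleton_iff_nontrivial,
    not_iff_not]
  exact ⟨fun h => h.subsingleton_connectedComponent, fun _ _ _ =>
    ConnectedComponent.exact (Subsingleton.elim _ _)⟩

theorem nonempty_of_isCutSet (hG : G.Connected) (hS : G.IsCutSet S) : S.Nonempty := by
  rw [Finset.nonempty_iff_ne_empty]
  rintro rfl
  rw [IsCutSet, Finset.coe_empty, Set.compl_empty, G.induceUnivIso.preconnected_iff] at hS
  exact hS hG.preconnected

theorem card_add_numCompDelete_le [Fintype V] (G : SimpleGraph V) (S : Finset V) :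
    S.card + G.numCompDelete S ≤ Fintype.card V := by
  classical
  have hcomp : G.numCompDelete S ≤ Sᶜ.card := by
    rw [← Set.ncard_coe_finset, Finset.coe_compl, ← Nat.card_coe_set_eq]
    exact Nat.card_le_card_of_surjective _ Quot.mk_surjective
  have := S.card_add_card_compl
  omega

theorem exists_superset_card_eq_le_numCompDelete [Fintype V] {c r : ℕ} (hc₀ : 0 < c)
    (hc : c ≤ G.numCompDelete S) (hr : S.card ≤ r) (hrc : r + c ≤ Fintype.card V) :
    ∃ T : Finset V, S ⊆ T ∧ T.card = r ∧ c ≤ G.numCompDelete T := by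
  classical
  have : Nonempty (Fin c) := ⟨⟨0, hc₀⟩⟩
  obtain ⟨F, hF, hsurj⟩ := exists_le_joinOfCliques_of_card_le_numCompDelete (G := G) (S := S)
    (ι := Fin c) (by simpa using hc)
  choose rep hrepS hrep using hsurj
  have hinj : Function.Injective rep := Function.LeftInverse.injective hrep
  obtain ⟨T, hST, hT, hcard⟩ := Finset.exists_subsuperset_card_eq
    (s := S) (t := (Finset.univ.image rep)ᶜ) (n := r)
    (fun v hv => by
      simp only [Finset.mem_compl, Finset.mem_image, not_exists]
      rintro i ⟨-, rfl⟩
      exact hrepS i hv) hr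
    (by rw [Finset.card_compl, Finset.card_image_of_injective _ hinj, Finset.card_fin]; omega)
  refine ⟨T, hST, hcard, ?_⟩
  have hsurj' : ∀ i, ∃ u ∉ T, F u = i := fun i => ⟨rep i, fun hi => by simpa using hT hi, hrep i⟩
  simpa using card_le_numCompDelete_of_le_joinOfCliques (hF.trans (joinOfCliques_mono hST)) hsurj'

theorem not_isTough_iff [Finite V] {t : ℝ} :
    ¬ G.IsTough t ↔ ∃ S, 1 < G.numCompDelete S ∧ (S.card : ℝ) < t * G.numCompDelete S := by
  simp only [IsTough, toughness, le_iInf₂_iff, EReal.coe_le_coe_iff, not_forall, not_le,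
    isCutSet_iff_one_lt_numCompDelete, exists_prop]
  refine exists_congr fun S => and_congr_right fun h => ?_
  rw [div_lt_iff₀ (Nat.cast_pos.2 (zero_lt_one.trans h))]

end Toughness

section AverageDistance

open SimpleGraph

theorem sum_sq_le_of_one_le {ι : Type*} [Fintype ι] {N : ι → ℝ} (hN : ∀ i, 1 ≤ N i) :
    ∑ i, N i ^ 2 ≤ (∑ i, N i - (Fintype.card ι - 1)) ^ 2 + (Fintype.card ι - 1) := by
  have hsq := Finset.sum_sq_le_sq_sum_of_nonneg (s := Finset.univ) (f := fun i => N i - 1)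
    fun i _ => sub_nonneg.2 (hN i)
  have hexpand : ∑ i, (N i - 1) ^ 2 = ∑ i, N i ^ 2 - 2 * ∑ i, N i + Fintype.card ι := by
    simp [sub_sq, Finset.sum_add_distrib, Finset.sum_sub_distrib, Finset.mul_sum]
  have hsum : ∑ i, (N i - 1) = ∑ i, N i - Fintype.card ι := by simp [Finset.sum_sub_distrib]
  rw [hexpand, hsum] at hsq
  linarith

variable {V : Type*} [Fintype V] {G : SimpleGraph V} {S : Finset V}

/-- The left-hand side is the sum of all distances in `K_s ∨ (K_{n - s - c + 1} + (c - 1) K₁)`. -/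
theorem le_dotProduct_joinOfCliques_distMatrix_mulVec_one {ι : Type*} [Fintype ι] {F : V → ι}
    (hS : S.Nonempty) (hsurj : ∀ i, ∃ u ∉ S, F u = i) :
    (Fintype.card V : ℝ) * (Fintype.card V - 1) + (Fintype.card ι - 1) *
      (2 * (Fintype.card V - S.card) - Fintype.card ι) ≤
      1 ⬝ᵥ (joinOfCliques S F).distMatrix *ᵥ 1 := by
  classical
  have hcompl : ((Sᶜ).card : ℝ) = Fintype.card V - S.card := by
    rw [Finset.card_compl, Nat.cast_sub S.card_le_univ]
  have hfib : ∑ i, (((Sᶜ.filter fun v => F v = i).card : ℝ)) = (Sᶜ).card := by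
    exact_mod_cast (Finset.card_eq_sum_card_fiberwise fun u _ => Finset.mem_univ (F u)).symm
  have hone : ∀ i, (1 : ℝ) ≤ (Sᶜ.filter fun v => F v = i).card := fun i => by
    obtain ⟨u, hu, hui⟩ := hsurj i
    exact Nat.one_le_cast.2 (Finset.card_pos.2 ⟨u, by simp [hu, hui]⟩)
  have hsq := sum_sq_le_of_one_le hone
  rw [hfib] at hsq
  simp only [dotProduct_joinOfCliques_distMatrix_mulVec hS, Pi.one_apply, one_pow,
    Finset.sum_const, nsmul_one, Finset.card_univ]
  rw [hcompl] at hsq ⊢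
  linarith

theorem le_distSpectralRadius_mul_card [DecidableEq V] (hG : G.Connected) (hS : S.Nonempty)
    (hc : 0 < G.numCompDelete S) :
    (Fintype.card V : ℝ) * (Fintype.card V - 1) + (G.numCompDelete S - 1) *
      (2 * (Fintype.card V - S.card) - G.numCompDelete S) ≤
      G.distSpectralRadius * Fintype.card V := by
  have : Nonempty (Fin (G.numCompDelete S)) := ⟨⟨0, hc⟩⟩
  obtain ⟨F, hF, hsurj⟩ := exists_le_joinOfCliques_of_card_le_numCompDelete (G := G) (S := S)
    (ι := Fin (G.numCompDelete S)) (Fintype.card_fin _).le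
  have hbound := le_dotProduct_joinOfCliques_distMatrix_mulVec_one hS hsurj
  rw [Fintype.card_fin] at hbound
  calc _ ≤ 1 ⬝ᵥ (joinOfCliques S F).distMatrix *ᵥ 1 := hbound
    _ ≤ 1 ⬝ᵥ G.distMatrix *ᵥ 1 :=
        dotProduct_mulVec_mono (distMatrix_anti hG hF) fun _ => zero_le_one
    _ ≤ G.distSpectralRadius * (1 ⬝ᵥ 1) := dotProduct_mulVec_le_maxEigenvalue_mul _ 1
    _ = G.distSpectralRadius * Fintype.card V := by rw [one_dotProduct_one]

end AverageDistance

section CliqueJoin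

open SimpleGraph Finset

variable {s m k : ℕ}

/-- The graphs `K_s ∨ (K_{n₁} + ⋯ + K_{n_{k+1}})` on the vertex set of `K_s ∨ (K_m + k K₁)`: a
vertex `i` of `K_m` stays in the first clique when `g i = none`, and is moved to the clique of the
`j`-th isolated vertex when `g i = some j`. -/
def multiCliqueJoin (s : ℕ) (g : Fin m → Option (Fin k)) :
    SimpleGraph (Fin s ⊕ (Fin m ⊕ Fin k)) :=
  joinOfCliques (univ.disjSum ∅) (Sum.elim (fun _ => none) (Sum.elim g some))

theorem cliqueJoin_eq_multiCliqueJoin :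
    cliqueJoin s m k = multiCliqueJoin s fun _ => none := by
  ext (u | u | u) (v | v | v) <;>
    simp [cliqueJoin, SimpleGraph.join, multiCliqueJoin, joinOfCliques_adj, eq_comm]

theorem nonempty_univ_disjSum (hs : 0 < s) :
    ((univ : Finset (Fin s)).disjSum (∅ : Finset (Fin m ⊕ Fin k))).Nonempty :=
  ⟨.inl ⟨0, hs⟩, by simp⟩

theorem multiCliqueJoin_connected (hs : 0 < s) (g : Fin m → Option (Fin k)) :
    (multiCliqueJoin s g).Connected :=
  joinOfCliques_connected (nonempty_univ_disjSum hs)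

theorem cliqueJoin_connected (hs : 0 < s) : (cliqueJoin s m k).Connected :=
  cliqueJoin_eq_multiCliqueJoin ▸ multiCliqueJoin_connected hs _

theorem sum_compl_disjSum (f : Fin s ⊕ (Fin m ⊕ Fin k) → ℝ) :
    ∑ v ∈ (univ.disjSum ∅)ᶜ, f v = ∑ b, f (.inr b) := by
  have hcompl : (univ.disjSum ∅)ᶜ =
      (∅ : Finset (Fin s)).disjSum (univ : Finset (Fin m ⊕ Fin k)) := by
    ext (v | v) <;> simp
  rw [hcompl, sum_disjSum, sum_empty, zero_add]

theorem cliqueJoin_distMatrix_mulVec (hs : 0 < s) (x : Fin s ⊕ (Fin m ⊕ Fin k) → ℝ)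
    (v : Fin s ⊕ (Fin m ⊕ Fin k)) :
    ((cliqueJoin s m k).distMatrix *ᵥ x) v = ∑ w, x w - x v + v.elim (fun _ => 0)
      (Sum.elim (fun _ => ∑ j, x (.inr (.inr j)))
        fun j => ∑ i, x (.inr (.inl i)) + ∑ j, x (.inr (.inr j)) - x (.inr (.inr j))) := by
  have herase : ∀ j : Fin k, ∑ i, (if i = j then 0 else x (.inr (.inr i))) =
      ∑ i, x (.inr (.inr i)) - x (.inr (.inr j)) := fun j => by
    simp [← sum_erase_eq_sub (mem_univ j), ← filter_ne', sum_filter]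
  rw [cliqueJoin_eq_multiCliqueJoin, multiCliqueJoin,
    joinOfCliques_distMatrix_mulVec (nonempty_univ_disjSum hs), sum_filter, sum_compl_disjSum,
    Fintype.sum_sum_type (fun b => ite _ _ _)]
  rcases v with i | i | j
  · simp
  · simp
  · simp [herase, add_sub_assoc]

/-- The vector on the vertices of `K_s ∨ (K_m + k K₁)` with value `c` on `K_s`, `q` on `K_m` and `p`
on the isolated vertices. -/
def blockVector (c q p : ℝ) : Fin s ⊕ (Fin m ⊕ Fin k) → ℝ :=
  Sum.elim (fun _ => c) (Sum.elim (fun _ => q) fun _ => p)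

theorem blockVector_pos {c q p : ℝ} (hc : 0 < c) (hq : 0 < q) (hp : 0 < p) :
    ∀ v : Fin s ⊕ (Fin m ⊕ Fin k), 0 < blockVector c q p v := by
  rintro (_ | _ | _) <;> assumption

theorem cliqueJoin_distMatrix_mulVec_blockVector (hs : 0 < s) (c q p : ℝ) :
    (cliqueJoin s m k).distMatrix *ᵥ blockVector c q p = blockVector
      (s * c + m * q + k * p - c) (s * c + m * q + 2 * k * p - q)
      (s * c + 2 * m * q + 2 * k * p - 2 * p) := by
  funext v
  rw [cliqueJoin_distMatrix_mulVec hs]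
  rcases v with i | i | j <;>
    simp only [blockVector, Fintype.sum_sum_type, Sum.elim_inl, Sum.elim_inr, sum_const, card_univ,
      Fintype.card_fin, nsmul_eq_mul] <;> ring

theorem cliqueJoin_distSpectralRadius_lt (hs : 0 < s) (hk : 0 < k) {a μ : ℝ} (ha : 0 < a)
    (hbig : s + m - 1 + 2 * k * a ≤ μ) (hsingle : s + 2 * m + 2 * (k - 1) * a ≤ μ * a) :
    (cliqueJoin s m k).distSpectralRadius < μ := by
  have hka : 0 < k * a := mul_pos (Nat.cast_pos.2 hk) ha
  refine distSpectralRadius_lt_of_distMatrix_mulVec_lt (cliqueJoin_connected hs)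
    (blockVector_pos one_pos one_pos ha) (Pi.lt_def.2 ⟨?_, .inl ⟨0, hs⟩, ?_⟩)
  · rw [cliqueJoin_distMatrix_mulVec_blockVector hs]
    rintro (_ | _ | _) <;> simp only [blockVector, Sum.elim_inl, Sum.elim_inr, Pi.smul_apply,
      smul_eq_mul] <;> linarith
  · rw [cliqueJoin_distMatrix_mulVec_blockVector hs]
    simp only [blockVector, Sum.elim_inl, Pi.smul_apply, smul_eq_mul]
    linarith

theorem exists_eq_blockVector (hs : 0 < s) {x : Fin s ⊕ (Fin m ⊕ Fin k) → ℝ} (hx : ∀ v, 0 < x v)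
    {μ : ℝ} (hDx : (cliqueJoin s m k).distMatrix *ᵥ x = μ • x) :
    ∃ c q p : ℝ, 0 < q ∧ p < 2 * q ∧ x = blockVector c q p := by
  set T := ∑ v, x v with hT
  set Q := ∑ i, x (.inr (.inl i)) with hQ
  set P := ∑ j, x (.inr (.inr j)) with hP
  have hrow := fun v => (cliqueJoin_distMatrix_mulVec hs x v).symm.trans (congrFun hDx v)
  simp only [← hT, ← hQ, ← hP, Pi.smul_apply, smul_eq_mul] at hrow
  have hdom : ∀ i, (μ + 1) * x (.inl i) = T := fun i => by
    have := hrow (.inl i)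
    rw [Sum.elim_inl] at this
    linarith
  have hbig : ∀ i, (μ + 1) * x (.inr (.inl i)) = T + P := fun i => by
    have := hrow (.inr (.inl i))
    rw [Sum.elim_inr, Sum.elim_inl] at this
    linarith
  have hsingle : ∀ j, (μ + 2) * x (.inr (.inr j)) = T + Q + P := fun j => by
    have := hrow (.inr (.inr j))
    rw [Sum.elim_inr, Sum.elim_inr] at this
    linarith
  have hT₀ : 0 < T := sum_pos (fun v _ => hx v) ⟨.inl ⟨0, hs⟩, mem_univ _⟩
  have hP₀ : 0 ≤ P := sum_nonneg fun j _ => (hx _).le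
  have hQT : Q < T := by
    have : 0 < ∑ i, x (.inl i) := sum_pos (fun i _ => hx _) ⟨⟨0, hs⟩, mem_univ _⟩
    rw [hT, Fintype.sum_sum_type, Fintype.sum_sum_type]
    linarith
  have hμ : 0 < μ + 1 := pos_of_mul_pos_left (hdom ⟨0, hs⟩ ▸ hT₀) (hx _).le
  have hμ' : 0 < μ + 2 := by linarith
  have hq : 0 < (T + P) / (μ + 1) := by positivity
  refine ⟨T / (μ + 1), (T + P) / (μ + 1), (T + Q + P) / (μ + 2), hq, ?_, funext ?_⟩
  · rw [div_lt_iff₀ hμ']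
    calc T + Q + P < 2 * (T + P) := by linarith
      _ = 2 * ((T + P) / (μ + 1)) * (μ + 1) := by field_simp
      _ < 2 * ((T + P) / (μ + 1)) * (μ + 2) := by gcongr; linarith
  · rintro (i | i | j)
    · exact eq_div_of_mul_eq hμ.ne' (mul_comm _ _ |>.trans (hdom i))
    · exact eq_div_of_mul_eq hμ.ne' (mul_comm _ _ |>.trans (hbig i))
    · exact eq_div_of_mul_eq hμ'.ne' (mul_comm _ _ |>.trans (hsingle j))

theorem sq_add_sum_sq_lt {κ : Type*} [Fintype κ] {a : κ → ℝ} {b q p : ℝ} (ha : ∀ j, 0 ≤ a j)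
    (hsum : 0 < ∑ j, a j) (hq : 0 < q) (hp : p < b * q) :
    (b * q) ^ 2 + ∑ j, (a j * q + p) ^ 2 <
      ((b + ∑ j, a j) * q) ^ 2 + Fintype.card κ * p ^ 2 := by
  have hexpand : ∑ j, (a j * q + p) ^ 2 =
      (∑ j, a j ^ 2) * q ^ 2 + 2 * p * q * ∑ j, a j + Fintype.card κ * p ^ 2 := by
    simp only [add_sq, mul_pow, sum_add_distrib, sum_mul, mul_sum, sum_const, card_univ,
      nsmul_eq_mul]
    congr 2
    exact sum_congr rfl fun j _ => by ring
  have hsq : (∑ j, a j ^ 2) * q ^ 2 ≤ (∑ j, a j) ^ 2 * q ^ 2 :=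
    mul_le_mul_of_nonneg_right (sum_sq_le_sq_sum_of_nonneg fun j _ => ha j) (sq_nonneg q)
  have hcross : 2 * p * q * ∑ j, a j < 2 * (b * q) * q * ∑ j, a j := by gcongr
  rw [hexpand]
  linarith

theorem dotProduct_multiCliqueJoin_distMatrix_mulVec (hs : 0 < s) (g : Fin m → Option (Fin k))
    (c q p : ℝ) :
    blockVector c q p ⬝ᵥ (multiCliqueJoin s g).distMatrix *ᵥ blockVector c q p =
      (s * c + m * q + k * p) ^ 2 - (s * c ^ 2 + m * q ^ 2 + k * p ^ 2) + ((m * q + k * p) ^ 2 -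
        ((#{i | g i = none} * q) ^ 2 + ∑ j, (#{i | g i = some j} * q + p) ^ 2)) := by
  have hfib : ∀ o, (∑ v ∈ (univ.disjSum ∅ : Finset (Fin s ⊕ (Fin m ⊕ Fin k)))ᶜ with
      Sum.elim (fun _ => none) (Sum.elim g some) v = o, blockVector c q p v) =
      #{i | g i = o} * q + o.elim 0 fun _ => p := fun o => by
    rw [sum_filter, sum_compl_disjSum, Fintype.sum_sum_type]
    change ∑ i, (if g i = o then q else 0) + ∑ j, (if some j = o then p else 0) = _
    rw [← sum_filter, sum_const, nsmul_eq_mul]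
    cases o <;> simp
  rw [multiCliqueJoin, dotProduct_joinOfCliques_distMatrix_mulVec (nonempty_univ_disjSum hs)]
  simp only [Fintype.sum_option, hfib, Option.elim_none, Option.elim_some, add_zero]
  simp only [sum_compl_disjSum, Fintype.sum_sum_type, blockVector, Sum.elim_inl, Sum.elim_inr,
    sum_const, card_univ, Fintype.card_fin, nsmul_eq_mul, add_assoc]

theorem cliqueJoin_distSpectralRadius_lt_multiCliqueJoin (hs : 0 < s) {g : Fin m → Option (Fin k)}
    (hnone : 1 < #{i | g i = none}) (hsome : ∃ i, g i ≠ none) :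
    (cliqueJoin s m k).distSpectralRadius < (multiCliqueJoin s g).distSpectralRadius := by
  have hconn := cliqueJoin_connected (m := m) (k := k) hs
  have := hconn.nonempty
  obtain ⟨x, hx, hDx⟩ := exists_pos_mulVec_eq_maxEigenvalue_smul
    (cliqueJoin s m k).distMatrix_isHermitian (distMatrix_pos hconn)
  have hxx : 0 < x ⬝ᵥ x := sum_pos (fun v _ => mul_pos (hx v) (hx v)) univ_nonempty
  obtain ⟨c, q, p, hq, hpq, rfl⟩ := exists_eq_blockVector hs hx hDx
  have hcard : (#{i | g i = none} : ℝ) + ∑ j, (#{i | g i = some j} : ℝ) = m := by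
    have := card_eq_sum_card_fiberwise (s := univ) (f := g) (t := univ) fun _ _ => mem_univ _
    rw [Fintype.sum_option, card_univ, Fintype.card_fin] at this
    exact_mod_cast this.symm
  have hsome' : (0 : ℝ) < ∑ j, (#{i | g i = some j} : ℝ) := by
    obtain ⟨i, hi⟩ := hsome
    obtain ⟨j, hj⟩ := Option.ne_none_iff_exists'.1 hi
    exact sum_pos' (fun j _ => Nat.cast_nonneg _)
      ⟨j, mem_univ j, Nat.cast_pos.2 (card_pos.2 ⟨i, by simp [hj]⟩)⟩
  have hlt := sq_add_sum_sq_lt (a := fun j => (#{i | g i = some j} : ℝ))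
    (b := #{i | g i = none}) (p := p) (fun j => Nat.cast_nonneg _) hsome' hq
    (hpq.trans_le (by gcongr; exact_mod_cast hnone))
  refine lt_of_mul_lt_mul_right ?_ hxx.le
  calc (cliqueJoin s m k).distSpectralRadius * (blockVector c q p ⬝ᵥ blockVector c q p)
      = blockVector c q p ⬝ᵥ (cliqueJoin s m k).distMatrix *ᵥ blockVector c q p := by
        rw [hDx, dotProduct_smul, smul_eq_mul, distSpectralRadius_eq_maxEigenvalue]
    _ < blockVector c q p ⬝ᵥ (multiCliqueJoin s g).distMatrix *ᵥ blockVector c q p := by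
        rw [cliqueJoin_eq_multiCliqueJoin, dotProduct_multiCliqueJoin_distMatrix_mulVec hs,
          dotProduct_multiCliqueJoin_distMatrix_mulVec hs]
        rw [hcard, Fintype.card_fin] at hlt
        simp only [filter_true, card_univ, Fintype.card_fin, reduceCtorEq, filter_false, card_empty,
          Nat.cast_zero, zero_mul, zero_add, sum_const, nsmul_eq_mul]
        linarith
    _ ≤ _ := dotProduct_mulVec_le_maxEigenvalue_mul _ _

theorem eq_cliqueJoin_of_le_multiCliqueJoin (hs : 0 < s) {g : Fin m → Option (Fin k)}
    (hnone : 1 < #{i | g i = none}) {G : SimpleGraph (Fin s ⊕ (Fin m ⊕ Fin k))}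
    (hG : G.Connected) (hGg : G ≤ multiCliqueJoin s g)
    (hle : G.distSpectralRadius ≤ (cliqueJoin s m k).distSpectralRadius) :
    G = cliqueJoin s m k := by
  by_cases hsome : ∃ i, g i ≠ none
  · exact absurd ((distSpectralRadius_anti hG hGg).trans hle)
      (cliqueJoin_distSpectralRadius_lt_multiCliqueJoin hs hnone hsome).not_ge
  · push Not at hsome
    obtain rfl : g = fun _ => none := funext hsome
    rw [← cliqueJoin_eq_multiCliqueJoin] at hGg
    exact eq_of_le_of_distSpectralRadius_le hG hGg hle

end CliqueJoin

section Recognition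

open SimpleGraph

theorem exists_equiv_sum_of_injective {α W : Type*} [Fintype α] [Fintype W] {f : α → W} {m : ℕ}
    (hf : Function.Injective f) (hcard : Fintype.card W = m + Fintype.card α) :
    ∃ e : Fin m ⊕ α ≃ W, ∀ a, e (.inr a) = f a := by
  classical
  have hcompl : Fintype.card ↥(Set.range f)ᶜ = m := by
    rw [Fintype.card_compl_set, Set.card_range_of_injective hf, hcard, Nat.add_sub_cancel]
  let e := (Equiv.sumCongr (Fintype.equivFinOfCardEq hcompl).symm (Equiv.ofInjective f hf)).trans
    ((Equiv.sumComm _ _).trans (Equiv.Set.sumCompl (Set.range f)))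
  exact ⟨e, fun a => rfl⟩

variable {V : Type*} {G : SimpleGraph V} {S : Finset V} {s m k : ℕ}

theorem not_isTough_of_iso_cliqueJoin {t : ℝ} (hm : 0 < m) (hk : 0 < k) (ht : 0 < t)
    (hst : (s : ℝ) < t * (k + 1)) (φ : G ≃g cliqueJoin s m k) : ¬ G.IsTough t := by
  have : Finite V := .of_equiv _ φ.symm.toEquiv
  let D : Finset (Fin s ⊕ (Fin m ⊕ Fin k)) := Finset.univ.disjSum ∅
  let S : Finset V := D.map φ.symm.toEquiv.toEmbedding
  have hmem : ∀ {u}, u ∈ S ↔ φ u ∈ D := Finset.mem_map_equiv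
  let colour : Fin s ⊕ (Fin m ⊕ Fin k) → Option (Fin k) :=
    Sum.elim (fun _ => none) (Sum.elim (fun _ => none) some)
  have hle : G ≤ joinOfCliques S (colour ∘ φ) := fun u v huv => by
    have hadj := cliqueJoin_eq_multiCliqueJoin.le (φ.map_adj_iff.2 huv)
    exact ⟨huv.ne, hadj.2.imp hmem.2 (Or.imp_left hmem.2)⟩
  have hsurj : ∀ o, ∃ u ∉ S, (colour ∘ φ) u = o := fun o => by
    suffices ∃ b, b ∉ D ∧ colour b = o by
      obtain ⟨b, hb, hbo⟩ := this
      exact ⟨φ.symm b, by rwa [hmem, φ.apply_symm_apply],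
        by rwa [Function.comp_apply, φ.apply_symm_apply]⟩
    cases o with
    | none => exact ⟨.inr (.inl ⟨0, hm⟩), by simp [D], rfl⟩
    | some j => exact ⟨.inr (.inr j), by simp [D], rfl⟩
  have hc : k + 1 ≤ G.numCompDelete S := by
    simpa using card_le_numCompDelete_of_le_joinOfCliques hle hsurj
  have hcard : S.card = s := by simp [S, D]
  refine not_isTough_iff.2 ⟨S, by omega, ?_⟩
  calc (S.card : ℝ) = s := by rw [hcard]
    _ < t * (k + 1) := hst
    _ ≤ t * G.numCompDelete S := by gcongr; exact_mod_cast hc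

variable [Fintype V]

theorem exists_equiv_of_representatives {r : Fin k → V} (hr : Function.Injective r)
    (hrS : ∀ j, r j ∉ S) (hS : S.card = s) (hcard : Fintype.card V = s + m + k) :
    ∃ e : Fin s ⊕ (Fin m ⊕ Fin k) ≃ V,
      (∀ i, e (.inl i) ∈ S) ∧ (∀ b, e (.inr b) ∉ S) ∧ ∀ j, e (.inr (.inr j)) = r j := by
  let eS := (S.equivFinOfCardEq hS).symm
  have hinj : Function.Injective (Sum.elim (fun i => (eS i).1) r) :=
    (Subtype.val_injective.comp eS.injective).sumElim hr fun i j h => hrS j (h ▸ (eS i).2)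
  obtain ⟨e, he⟩ := exists_equiv_sum_of_injective (m := m) hinj
    (by simp only [Fintype.card_sum, Fintype.card_fin]; omega)
  let e' := (Equiv.sumAssoc _ _ _).symm.trans ((Equiv.sumCongr (Equiv.sumComm _ _)
    (Equiv.refl (Fin k))).trans ((Equiv.sumAssoc _ _ _).trans e))
  have heS : ∀ i, e' (.inl i) = eS i := fun i => he (.inl i)
  refine ⟨e', fun i => heS i ▸ (eS i).2, ?_, fun j => he (.inr j)⟩
  intro b hb
  have heq : e' (.inl (eS.symm ⟨_, hb⟩)) = e' (.inr b) :=
    (heS _).trans (congrArg Subtype.val (eS.apply_symm_apply _))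
  exact Sum.inl_ne_inr (e'.injective heq)

theorem exists_iso_le_multiCliqueJoin (hm : 1 < m) (hcard : Fintype.card V = s + m + k)
    (hS : S.card = s) (hc : k + 1 ≤ G.numCompDelete S) :
    ∃ (H : SimpleGraph (Fin s ⊕ (Fin m ⊕ Fin k))) (g : Fin m → Option (Fin k)),
      Nonempty (G ≃g H) ∧ H ≤ multiCliqueJoin s g ∧
        1 < (Finset.univ.filter fun i => g i = none).card := by
  classical
  obtain ⟨F, hF, hsurj, hfib⟩ := exists_le_joinOfCliques_one_lt_card_fiber
    (none : Option (Fin k)) (by simpa using hc)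
    (by rw [Fintype.card_option, Fintype.card_fin, Finset.card_compl]; omega)
  choose r hrS hr using fun j => hsurj (some j)
  have hinj : Function.Injective r := fun i j hij =>
    Option.some_injective _ ((hr i).symm.trans ((congrArg F hij).trans (hr j)))
  obtain ⟨e, heS, heS', her⟩ := exists_equiv_of_representatives hinj hrS hS hcard
  have hcolour : ∀ b, Sum.elim (fun i => F (e (.inr (.inl i)))) some b = F (e (.inr b)) := by
    rintro (i | j)
    · rfl
    · exact ((congrArg F (her j)).trans (hr j)).symm
  refine ⟨G.comap e, fun i => F (e (.inr (.inl i))), ⟨(Iso.comap e G).symm⟩, fun a b hab => ?_,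
    hfib.trans_le (Finset.card_le_card_of_surjOn (fun i => e (.inr (.inl i))) fun u hu => ?_)⟩
  · refine ⟨hab.ne, ?_⟩
    rcases a with a | a
    · exact .inl (by simp)
    rcases b with b | b
    · exact .inr (.inl (by simp))
    have hFab := ((hF hab).2.resolve_left (heS' a)).resolve_left (heS' b)
    exact .inr (.inr ((hcolour a).trans (hFab.trans (hcolour b).symm)))
  · obtain ⟨huS, hu⟩ := Finset.mem_filter.1 hu
    obtain ⟨i | i | j, rfl⟩ := e.surjective u
    · exact absurd (heS i) (Finset.mem_compl.1 huS)
    · exact ⟨i, Finset.mem_coe.2 (Finset.mem_filter.2 ⟨Finset.mem_univ i, hu⟩), rfl⟩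
    · exact absurd ((hcolour (.inr j)).trans hu) (Option.some_ne_none j)

theorem nonempty_iso_cliqueJoin_of_le_numCompDelete [DecidableEq V] (hG : G.Connected)
    (hs : 0 < s) (hm : 1 < m) (hcard : Fintype.card V = s + m + k) (hS : S.card = s)
    (hc : k + 1 ≤ G.numCompDelete S)
    (hle : G.distSpectralRadius ≤ (cliqueJoin s m k).distSpectralRadius) :
    Nonempty (G ≃g cliqueJoin s m k) := by
  obtain ⟨H, g, ⟨φ⟩, hHg, hnone⟩ := exists_iso_le_multiCliqueJoin hm hcard hS hc
  rw [distSpectralRadius_eq_of_iso hG φ] at hle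
  exact eq_cliqueJoin_of_le_multiCliqueJoin hs hnone (φ.connected_iff.1 hG) hHg hle ▸ ⟨φ⟩

end Recognition

section Estimates

open SimpleGraph

theorem three_mul_le_of_add_one_le_mul {n s c t : ℝ} (ht : 1 ≤ t) (hn : 4 * t ^ 2 + 10 * t ≤ n)
    (hc : 3 ≤ c) (hs : s + 1 ≤ t * c) (hsc : s + c ≤ n) :
    3 * n ≤ (c - 1) * (2 * (n - s) - c) := by
  rcases le_total ((t + 1) * c) (n + 1) with hcn | hcn
  · have hx : 0 ≤ c - 3 := sub_nonneg.2 hc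
    have hconst : 0 ≤ n - 12 * t - 2 := by
      nlinarith [mul_nonneg (sub_nonneg.2 ht) (by linarith : 0 ≤ 4 * t + 2)]
    have hlin : (2 * t + 1) * (c - 3) ≤ 2 * n - 10 * t - 3 := by
      rcases le_total (c - 3) (4 * t) with hct | hct
      · calc (2 * t + 1) * (c - 3) ≤ (2 * t + 1) * (4 * t) := by gcongr
          _ ≤ 2 * n - 10 * t - 3 := by linarith
      · linarith
    calc 3 * n ≤ 3 * n + ((n - 12 * t - 2) +
          (c - 3) * (2 * n - 10 * t - 3 - (2 * t + 1) * (c - 3))) :=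
        le_add_of_nonneg_right (add_nonneg hconst (mul_nonneg hx (sub_nonneg.2 hlin)))
      _ = (c - 1) * (2 * (n - (t * c - 1)) - c) := by ring
      _ ≤ (c - 1) * (2 * (n - s) - c) :=
        mul_le_mul_of_nonneg_left (by linarith) (by linarith)
  · have hct : 3 * (t + 1) ≤ c - 1 := by
      by_contra! h
      have : (t + 1) * c ≤ (t + 1) * (3 * t + 4) := by gcongr; linarith
      nlinarith
    calc 3 * n ≤ 3 * ((t + 1) * c) := by linarith
      _ = 3 * (t + 1) * c := by ring
      _ ≤ (c - 1) * c := by gcongr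
      _ ≤ (c - 1) * (2 * (n - s) - c) :=
        mul_le_mul_of_nonneg_left (by linarith) (by linarith)

theorem mul_le_of_mul_add_one_le {n s c k : ℝ} (hk : 1 ≤ k)
    (hkn : 4 + 9 * k ^ 2 + 9 * k ≤ 2 * k * n) (hs : 2 ≤ s) (hsc : s + c ≤ n)
    (hc : k * s + 1 ≤ c) :
    2 * k * (2 * n - 5 - 2 * k) ≤ (c - 1) * (2 * (n - s) - c) := by
  have hsn : 2 * k + 4 + s ≤ n := by
    by_contra! h
    have : (k + 1) * (n - 2 * k - 4) ≤ (k + 1) * s := by gcongr; linarith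
    nlinarith [mul_nonneg (sub_nonneg.2 hk) (by linarith : 0 ≤ 5 * k + 2)]
  have hsk : 0 ≤ 2 * n - 1 - (s + 2) * (k + 2) := by linarith
  have hc₀ : 0 ≤ 2 * (n - s) - c - k * s := by linarith
  calc 2 * k * (2 * n - 5 - 2 * k)
      ≤ 2 * k * (2 * n - 5 - 2 * k) + k * (s - 2) * (2 * n - 1 - (s + 2) * (k + 2)) :=
        le_add_of_nonneg_right (mul_nonneg (mul_nonneg (by linarith) (sub_nonneg.2 hs)) hsk)
    _ = k * s * (2 * (n - s) - (k * s + 1)) := by ring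
    _ ≤ k * s * (2 * (n - s) - (k * s + 1)) +
          (c - (k * s + 1)) * (2 * (n - s) - c - k * s) :=
        le_add_of_nonneg_right (mul_nonneg (sub_nonneg.2 hc) hc₀)
    _ = (c - 1) * (2 * (n - s) - c) := by ring

theorem cliqueJoin_singleton_distSpectralRadius_lt {s m : ℕ} (hs : 0 < s) :
    (cliqueJoin s m 1).distSpectralRadius < s + m + 3 := by
  refine cliqueJoin_distSpectralRadius_lt hs one_pos two_pos ?_ ?_ <;>
    rw [Nat.cast_one] <;> linarith

theorem two_mul_sq_mul_le_of_nine_halves_le {n k : ℝ} (hk : 1 ≤ k) (hn : 9 / 2 * (k + 1) ≤ n) :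
    2 * n ^ 2 * (2 * n - 2 * k - 1) ≤
      (n ^ 2 + n + 2 * k * n - 10 * k - 4 * k ^ 2) * (5 * n - 10 - 4 * k) := by
  obtain ⟨w, hw, rfl⟩ : ∃ w, 0 ≤ w ∧ n = 9 / 2 * (k + 1) + w := ⟨_, sub_nonneg.2 hn, by ring⟩
  obtain ⟨l, hl, rfl⟩ : ∃ l, 0 ≤ l ∧ k = 1 + l := ⟨_, sub_nonneg.2 hk, by ring⟩
  rw [← sub_nonneg]
  ring_nf
  positivity

theorem cliqueJoin_one_distSpectralRadius_lt {n m k : ℕ} (hk : 0 < k) (hnm : n = 1 + m + k)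
    (hn : 9 / 2 * ((k : ℝ) + 1) ≤ n) :
    (cliqueJoin 1 m k).distSpectralRadius < (n : ℝ) - 1 + 2 * k * (2 * n - 5 - 2 * k) / n := by
  have hm : (m : ℝ) = n - 1 - k := by
    rw [hnm]
    push_cast
    ring
  have hk' : (1 : ℝ) ≤ k := Nat.one_le_cast.2 hk
  have hn₀ : 0 < n := by linarith
  -- The value on the isolated vertices is the one for which the row of `K_m` is an equality.
  refine cliqueJoin_distSpectralRadius_lt one_pos hk (a := (5 * n - 10 - 4 * k) / (2 * n))
    (div_pos (by linarith) (by linarith)) ?_ ?_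
  · rw [hm, Nat.cast_one]
    field_simp
    linarith
  · rw [hm, Nat.cast_one, ← le_sub_iff_add_le, ← sub_mul]
    calc 1 + 2 * ((n : ℝ) - 1 - k) = 2 * n - 2 * k - 1 := by ring
      _ ≤ ((n : ℝ) ^ 2 + n + 2 * k * n - 10 * k - 4 * k ^ 2) * (5 * n - 10 - 4 * k) /
          (2 * n ^ 2) := by
        rw [le_div_iff₀' (by positivity)]
        exact two_mul_sq_mul_le_of_nine_halves_le hk' hn
      _ = _ := by
        field_simp
        ring

end Estimates

section ToughnessCriterion

open SimpleGraph

variable {V : Type*} [Fintype V] [DecidableEq V] {G : SimpleGraph V}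

theorem isTough_iff_of_forall_exists_card_eq {s m k : ℕ} {t : ℝ} (hG : G.Connected) (hs : 0 < s)
    (hm : 1 < m) (hk : 0 < k) (ht : 0 < t) (hcard : Fintype.card V = s + m + k)
    (hst : (s : ℝ) < t * (k + 1))
    (hle : G.distSpectralRadius ≤ (cliqueJoin s m k).distSpectralRadius)
    (hcut : ∀ S : Finset V, 1 < G.numCompDelete S → (S.card : ℝ) < t * G.numCompDelete S →
      ∃ T : Finset V, T.card = s ∧ k + 1 ≤ G.numCompDelete T) :
    G.IsTough t ↔ ¬ Nonempty (G ≃g cliqueJoin s m k) := by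
  rw [iff_not_comm, iff_comm, not_isTough_iff]
  constructor
  · rintro ⟨S, hS, hSt⟩
    obtain ⟨T, hT, hc⟩ := hcut S hS hSt
    exact nonempty_iso_cliqueJoin_of_le_numCompDelete hG hs hm hcard hT hc hle
  · rintro ⟨φ⟩
    exact not_isTough_iff.1 (not_isTough_of_iso_cliqueJoin (by omega) hk ht hst φ)

theorem numCompDelete_le_two_of_distSpectralRadius_lt {t : ℕ} (hG : G.Connected) (ht : 0 < t)
    (hn : 4 * t ^ 2 + 10 * t ≤ Fintype.card V)
    (hle : G.distSpectralRadius < Fintype.card V + 2) {S : Finset V}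
    (hS : 1 < G.numCompDelete S) (hSt : S.card < t * G.numCompDelete S) :
    G.numCompDelete S ≤ 2 := by
  by_contra! hc
  have hS₀ := nonempty_of_isCutSet hG (isCutSet_iff_one_lt_numCompDelete.2 hS)
  have hlower := le_distSpectralRadius_mul_card hG hS₀ (zero_lt_one.trans hS)
  have hexcess := three_mul_le_of_add_one_le_mul (n := Fintype.card V) (s := S.card)
    (c := G.numCompDelete S) (t := t) (by exact_mod_cast ht) (by exact_mod_cast hn)
    (by exact_mod_cast hc) (by exact_mod_cast hSt)
    (by exact_mod_cast card_add_numCompDelete_le G S)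
  have := hG.nonempty
  have hn₀ : (0 : ℝ) < Fintype.card V := Nat.cast_pos.2 Fintype.card_pos
  have hupper := mul_lt_mul_of_pos_right hle hn₀
  linarith

theorem card_le_one_of_distSpectralRadius_lt {k : ℕ} (hG : G.Connected) (hk : 0 < k)
    (hkn : 4 + 9 * (k : ℝ) ^ 2 + 9 * k ≤ 2 * k * Fintype.card V)
    (hle : G.distSpectralRadius < (Fintype.card V : ℝ) - 1 +
      2 * k * (2 * Fintype.card V - 5 - 2 * k) / Fintype.card V) {S : Finset V}
    (hc : 0 < G.numCompDelete S) (hSk : k * S.card < G.numCompDelete S) : S.card ≤ 1 := by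
  by_contra! hS
  have hlower := le_distSpectralRadius_mul_card hG (Finset.card_pos.1 (by omega)) hc
  have hexcess := mul_le_of_mul_add_one_le (n := Fintype.card V) (s := S.card)
    (c := G.numCompDelete S) (k := k) (by exact_mod_cast hk) hkn
    (by exact_mod_cast hS) (by exact_mod_cast card_add_numCompDelete_le G S)
    (by exact_mod_cast hSk)
  have := hG.nonempty
  have hn₀ : (0 : ℝ) < Fintype.card V := Nat.cast_pos.2 Fintype.card_pos
  have hupper := mul_lt_mul_of_pos_right hle hn₀
  rw [add_mul, div_mul_cancel₀ _ hn₀.ne'] at hupper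
  linarith

theorem isTough_natCast_iff {n t : ℕ} (hG : G.Connected) (hV : Fintype.card V = n) (ht : 0 < t)
    (hn : 4 * t ^ 2 + 10 * t ≤ n)
    (hle : G.distSpectralRadius ≤ (cliqueJoin (2 * t - 1) (n - 2 * t) 1).distSpectralRadius) :
    G.IsTough t ↔ ¬ Nonempty (G ≃g cliqueJoin (2 * t - 1) (n - 2 * t) 1) := by
  have hnt : 14 * t ≤ n := by nlinarith
  have hst : ((2 * t - 1 : ℕ) : ℝ) + 1 = 2 * t := by exact_mod_cast (by omega)
  have hsm : ((2 * t - 1 : ℕ) : ℝ) + (n - 2 * t : ℕ) + 1 = n := by exact_mod_cast (by omega)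
  refine isTough_iff_of_forall_exists_card_eq hG (by omega) (by omega) one_pos
    (by exact_mod_cast ht) (by omega) (by push_cast; linarith) hle fun S hS hSt => ?_
  have hSt' : S.card < t * G.numCompDelete S := by exact_mod_cast hSt
  have hlt := hle.trans_lt (cliqueJoin_singleton_distSpectralRadius_lt (by omega))
  have hc : G.numCompDelete S = 2 := le_antisymm
    (numCompDelete_le_two_of_distSpectralRadius_lt hG ht (hV ▸ hn) (by rw [hV]; linarith) hS
      hSt') hS
  rw [hc] at hSt'
  obtain ⟨T, -, hT⟩ := exists_superset_card_eq_le_numCompDelete (r := 2 * t - 1) two_pos hc.ge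
    (by omega) (by omega)
  exact ⟨T, hT⟩

theorem isTough_one_div_iff {n k : ℕ} {t : ℝ} (hG : G.Connected) (hV : Fintype.card V = n)
    (hk : 0 < k) (htk : 1 / t = k) (hn : 2 * t + 9 / (2 * t) + 9 / 2 ≤ n)
    (hle : G.distSpectralRadius ≤ (cliqueJoin 1 (n - 1 - k) k).distSpectralRadius) :
    G.IsTough t ↔ ¬ Nonempty (G ≃g cliqueJoin 1 (n - 1 - k) k) := by
  have hk₀ : (0 : ℝ) < k := Nat.cast_pos.2 hk
  obtain rfl : t = 1 / k := by rw [← htk, one_div_one_div]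
  have hn' : 2 / k + 9 / 2 * ((k : ℝ) + 1) ≤ n := by
    convert hn using 1
    field_simp
    ring
  have hkn : 4 + 9 * (k : ℝ) ^ 2 + 9 * k ≤ 2 * k * n := by
    calc 4 + 9 * (k : ℝ) ^ 2 + 9 * k = 2 * k * (2 / k + 9 / 2 * (k + 1)) := by field_simp; ring
      _ ≤ 2 * k * n := by gcongr
  have hkn' : 9 / 2 * ((k : ℝ) + 1) ≤ n := (le_add_of_nonneg_left (by positivity)).trans hn'
  have hkn'' : 9 * (k + 1) ≤ 2 * n := by
    have : 9 * ((k : ℝ) + 1) ≤ 2 * n := by linarith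
    exact_mod_cast this
  refine isTough_iff_of_forall_exists_card_eq hG one_pos (by omega) hk (by positivity) (by omega)
    ?_ hle fun S hS hSt => ?_
  · rw [one_div_mul_eq_div, lt_div_iff₀ hk₀]
    push_cast
    linarith
  rw [one_div_mul_eq_div, lt_div_iff₀' hk₀] at hSt
  have hSk : k * S.card < G.numCompDelete S := by exact_mod_cast hSt
  have hS₀ := (nonempty_of_isCutSet hG (isCutSet_iff_one_lt_numCompDelete.2 hS)).card_pos
  have hlt := hle.trans_lt (cliqueJoin_one_distSpectralRadius_lt hk (by omega) hkn')
  have hS₁ : S.card = 1 := le_antisymm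
    (card_le_one_of_distSpectralRadius_lt hG hk (hV.symm ▸ hkn) (hV.symm ▸ hlt)
      (zero_lt_one.trans hS) hSk) hS₀
  exact ⟨S, hS₁, by rwa [hS₁, mul_one] at hSk⟩

end ToughnessCriterion

end DistanceToughness

theorem theorem2 {V : Type*} [Fintype V] [DecidableEq V] (G : SimpleGraph V) (n : ℕ)
    (hG : G.Connected) (hn : Fintype.card V = n) :
    (∀ t : ℕ, 0 < t → 4 * t ^ 2 + 10 * t ≤ n →
      G.distSpectralRadius ≤
        (SimpleGraph.cliqueJoin (2 * t - 1) (n - 2 * t) 1).distSpectralRadius →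
      (G.IsTough (t : ℝ) ↔
        ¬ Nonempty (G ≃g SimpleGraph.cliqueJoin (2 * t - 1) (n - 2 * t) 1))) ∧
    (∀ (t : ℝ) (k : ℕ), 0 < k → 1 / t = (k : ℝ) →
      2 * t + 9 / (2 * t) + 9 / 2 ≤ (n : ℝ) →
      G.distSpectralRadius ≤
        (SimpleGraph.cliqueJoin 1 (n - 1 - k) k).distSpectralRadius →
      (G.IsTough t ↔
        ¬ Nonempty (G ≃g SimpleGraph.cliqueJoin 1 (n - 1 - k) k))) :=
  ⟨fun _ ht hnt hle => DistanceToughness.isTough_natCast_iff hG hn ht hnt hle,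
    fun _ _ hk htk hnt hle => DistanceToughness.isTough_one_div_iff hG hn hk htk hnt hle⟩
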